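/- **Theorem ($\mathcal V_{\mathcal K}X$ is the free weakly locally convex $\mathcal K$-cone over $X$).** *Conventions.* A $\mathsf K$-category $\mathcal K$ is a full subcategory of the category of $T_0$ spaces (its objects are called $\mathcal K$-spaces) such that: homeomorphic copies of $\mathcal K$-spaces are $\mathcal K$-spaces; every sober space is a $\mathcal K$-space; in a sober space, the intersection of any family of $\mathcal K$-subspaces is a $\mathcal K$-subspace; and for every continuous map $f\colon S\to T$ of sober spaces and every $\mathcal K$-subspace $B$ of $T$, $f^{-1}(B)$ is a $\mathcal K$-subspace of $S$. A cone is a commutative monoid with a scalar multiplication by $\mathbb R_+=[0,\infty)$ that satisfies the axioms of a vector space (including $0\cdot x=0$ and $r\cdot 0=0$). A topological cone is a cone with a $T_0$ topology that makes addition and scalar multiplication jointly continuous, where $\mathbb R_+$ carries the Scott topology (whose proper nonempty open sets are the sets $(r,\infty)$, $r\ge 0$). It is weakly locally convex if every open neighbourhood of every point $x$ contains a convex (not necessarily open) neighbourhood of $x$. A $\mathcal K$-cone is a topological cone that is a $\mathcal K$-space. A map of cones is linear if it is additive and commutes with multiplication by all $r\in\mathbb R_+$. For a $T_0$ space $X$,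 $\mathcal V_wX$ is the cone, with pointwise operations, of all continuous valuations on $X$, that is, of all strict, monotone, modular and Scott-continuous maps $\mu$ from the lattice of open sets of $X$ to $[0,\infty]$; its topology is generated by the sets $\{\mu\mid\mu(U)>r\}$ with $U$ open in $X$ and $r\in\mathbb R_+$. The Dirac mass $\delta_x$ takes the value $1$ on the open sets that contain $x$ and $0$ on the others, and $\mathcal V_{\mathrm s}X\subseteq\mathcal V_wX$ is the subspace of simple valuations $\sum_{i=1}^n r_i\delta_{x_i}$ ($x_i\in X$, $r_i\in\mathbb R_+$). Finally, $\mathcal V_{\mathcal K}X$ is the smallest $\mathcal K$-subspace of $\mathcal V_wX$ that contains $\mathcal V_{\mathrm s}X$, with the subspace topology and the cone operations of $\mathcal V_wX$. *Statement.* Let $\mathcal K$ be a $\mathsf K$-category and $X$ a $T_0$ space. Then $\mathcal V_{\mathcal K}X$ is the $\mathcal K$-completion of $\mathcal V_{\mathrm s}X$: it is a $\mathcal K$-space, the inclusion $\mathcal V_{\mathrm s}X\to\mathcal V_{\mathcal K}X$ is a topological embedding, and every continuous map from $\mathcal V_{\mathrm s}X$ to a $\mathcal K$-space extends uniquely to a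 continuous map on $\mathcal V_{\mathcal K}X$. Moreover, $\mathcal V_{\mathcal K}X$ is a subcone of $\mathcal V_wX$ and is a weakly locally convex $\mathcal K$-cone, and for every continuous map $f\colon X\to C$ to a weakly locally convex $\mathcal K$-cone $C$ there is a unique continuous linear map $\overline f\colon\mathcal V_{\mathcal K}X\to C$ with $\overline f(\delta_x)=f(x)$ for all $x\in X$. -/

import Mathlib

open TopologicalSpace Topology
open scoped NNReal ENNReal

universe u

/-! ### Continuous valuations and the weak topology -/

/-- A continuous valuation on `X`: a strict, monotone, modular and Scott-continuous map from the
lattice of open sets of `X` to the extended nonnegative reals. -/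
@[ext]
structure ContinuousValuation (X : Type u) [TopologicalSpace X] where
  /-- The value of the valuation on an open set. -/
  toFun : Opens X → ℝ≥0∞
  strict : toFun ⊥ = 0
  mono : Monotone toFun
  modular : ∀ U V : Opens X, toFun U + toFun V = toFun (U ⊔ V) + toFun (U ⊓ V)
  scott : ScottContinuous toFun

namespace ContinuousValuation

variable {X : Type u} [TopologicalSpace X]

instance instCoeFun : CoeFun (ContinuousValuation X) (fun _ => Opens X → ℝ≥0∞) := ⟨toFun⟩

/-- The weak topology, generated by the sets `[U > r] = {μ | μ U > r}` with `U` open and `r` a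
nonnegative real number. With this topology, `ContinuousValuation X` is the extended
probabilistic powerdomain of `X`. -/
instance instTopologicalSpace : TopologicalSpace (ContinuousValuation X) :=
  generateFrom {W | ∃ (U : Opens X) (r : ℝ≥0), W = {μ : ContinuousValuation X | (r : ℝ≥0∞) < μ U}}

theorem scott_add (μ ν : ContinuousValuation X) :
    ScottContinuous (fun U => μ U + ν U) := by
  intro d hne hd a ha
  have hμ : μ a = ⨆ U : d, μ U.1 := by
    rw [← (μ.scott hne hd ha).sSup_eq, sSup_image']
  have hν : ν a = ⨆ U : d, ν U.1 := by
    rw [← (ν.scott hne hd ha).sSup_eq, sSup_image']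
  have key : (μ a + ν a) = ⨆ U : d, (μ U.1 + ν U.1) := by
    rw [hμ, hν]
    refine ENNReal.iSup_add_iSup ?_
    intro U V
    obtain ⟨W, hW, hUW, hVW⟩ := hd U.1 U.2 V.1 V.2
    exact ⟨⟨W, hW⟩, add_le_add (μ.mono hUW) (ν.mono hVW)⟩
  have h := isLUB_sSup ((fun U => μ U + ν U) '' d)
  rw [sSup_image'] at h
  show IsLUB _ (μ a + ν a)
  rw [key]
  exact h

theorem scott_smul (r : ℝ≥0) (μ : ContinuousValuation X) :
    ScottContinuous (fun U => (r : ℝ≥0∞) * μ U) := by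
  intro d hne hd a ha
  have hμ : μ a = ⨆ U : d, μ U.1 := by
    rw [← (μ.scott hne hd ha).sSup_eq, sSup_image']
  have h := isLUB_sSup ((fun U => (r : ℝ≥0∞) * μ U) '' d)
  rw [sSup_image', ← ENNReal.mul_iSup, ← hμ] at h
  exact h

/-- The zero valuation. -/
instance instZero : Zero (ContinuousValuation X) where
  zero :=
    { toFun := fun _ => 0
      strict := rfl
      mono := fun _ _ _ => le_rfl
      modular := fun _ _ => rfl
      scott := ScottContinuous.const 0 }

/-- Pointwise addition. -/
instance instAdd : Add (ContinuousValuation X) where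
  add μ ν :=
    { toFun := fun U => μ U + ν U
      strict := by simp [μ.strict, ν.strict]
      mono := fun _ _ h => add_le_add (μ.mono h) (ν.mono h)
      modular := fun U V => by
        rw [add_add_add_comm, μ.modular, ν.modular, add_add_add_comm]
      scott := scott_add μ ν }

/-- Pointwise multiplication by a nonnegative real number. -/
noncomputable instance instSMul : SMul ℝ≥0 (ContinuousValuation X) where
  smul r μ :=
    { toFun := fun U => (r : ℝ≥0∞) * μ U
      strict := by simp [μ.strict]
      mono := fun _ _ h => mul_le_mul_right (μ.mono h) _
      modular := fun U V => by rw [← mul_add, ← mul_add, μ.modular]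
      scott := scott_smul r μ }

@[simp] theorem zero_apply (U : Opens X) : (0 : ContinuousValuation X) U = 0 := rfl

@[simp] theorem add_apply (μ ν : ContinuousValuation X) (U : Opens X) :
    (μ + ν) U = μ U + ν U := rfl

@[simp] theorem smul_apply (r : ℝ≥0) (μ : ContinuousValuation X) (U : Opens X) :
    (r • μ) U = (r : ℝ≥0∞) * μ U := rfl

instance instAddCommMonoid : AddCommMonoid (ContinuousValuation X) where
  add_assoc μ ν ξ := by ext U; simp [add_assoc]
  zero_add μ := by ext U; simp
  add_zero μ := by ext U; simp
  add_comm μ ν := by ext U; simp [add_comm]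
  nsmul := nsmulRec

/-- The canonical cone structure on continuous valuations. -/
noncomputable instance instModule : Module ℝ≥0 (ContinuousValuation X) where
  one_smul μ := by ext U; simp
  mul_smul r s μ := by ext U; simp [mul_assoc]
  smul_zero r := by ext U; simp
  smul_add r μ ν := by ext U; simp [mul_add]
  add_smul r s μ := by ext U; simp [add_mul]
  zero_smul μ := by ext U; simp

open Classical in
/-- The Dirac mass at `x`: its value at `U` is `1` if `x ∈ U` and `0` otherwise. -/
noncomputable def dirac (x : X) : ContinuousValuation X where
  toFun U := if x ∈ U then 1 else 0
  strict := by simp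
  mono := fun U V h => by
    by_cases hU : x ∈ U
    · simp [hU, h hU]
    · simp [hU]
  modular := fun U V => by
    by_cases hU : x ∈ U <;> by_cases hV : x ∈ V <;> simp [hU, hV]
  scott := by
    intro d _ _ a ha
    constructor
    · rintro _ ⟨U, hU, rfl⟩
      by_cases hx : x ∈ U
      · simp [hx, ha.1 hU hx]
      · simp [hx]
    · intro b hb
      by_cases hx : x ∈ a
      · rw [← ha.sSup_eq] at hx
        obtain ⟨U, hU, hxU⟩ := Opens.mem_sSup.1 hx
        have h := hb ⟨U, hU, rfl⟩
        simp only [if_pos hxU] at h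
        refine le_trans (b := (1 : ℝ≥0∞)) ?_ h
        show (if x ∈ a then (1 : ℝ≥0∞) else 0) ≤ 1
        split_ifs <;> simp
      · simp [hx]

end ContinuousValuation

/-- The simple valuations on `X`: the finite linear combinations, with nonnegative real
coefficients, of Dirac masses. They carry the subspace topology of the weak topology. -/
noncomputable def simpleValuations (X : Type u) [TopologicalSpace X] :
    Submodule ℝ≥0 (ContinuousValuation X) :=
  Submodule.span ℝ≥0 (Set.range ContinuousValuation.dirac)

/-! ### Cones

A cone is a commutative monoid with a scalar multiplication by nonnegative reals that satisfies
the axioms of a vector space, that is, a module over the semiring `ℝ≥0`. -/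

/-- A topological cone: a cone with a `T₀` topology for which addition and scalar multiplication
are jointly continuous, where the scalars carry the Scott topology. -/
structure IsTopologicalCone (C : Type u) [TopologicalSpace C] [AddCommMonoid C] [Module ℝ≥0 C] :
    Prop where
  t0 : T0Space C
  continuous_add : Continuous fun p : C × C => p.1 + p.2
  continuous_smul : Continuous fun p : WithScott ℝ≥0 × C => WithScott.ofScott p.1 • p.2

/-- Every open neighbourhood of every point contains a convex, not necessarily open,
neighbourhood of that point. -/
def IsWeaklyLocallyConvex (C : Type u) [TopologicalSpace C] [AddCommMonoid C] [Module ℝ≥0 C] :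
    Prop :=
  ∀ (x : C) (U : Set C), IsOpen U → x ∈ U → ∃ A : Set C, A ⊆ U ∧ A ∈ 𝓝 x ∧ Convex ℝ≥0 A

/-! ### `K`-categories and `K`-completions -/

/-- The full subcategory of the category of topological spaces whose objects are the spaces that
satisfy `K` is a `K`-category. A sober space is a quasi-sober `T₀` space. -/
structure IsKCategory (K : ∀ (Y : Type u) [TopologicalSpace Y], Prop) : Prop where
  /-- All `K`-spaces are `T₀` spaces. -/
  t0 : ∀ (Y : Type u) [TopologicalSpace Y], K Y → T0Space Y
  /-- Homeomorphic copies of `K`-spaces are `K`-spaces. -/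
  homeomorph : ∀ (Y Z : Type u) [TopologicalSpace Y] [TopologicalSpace Z],
    Nonempty (Y ≃ₜ Z) → K Y → K Z
  /-- All sober spaces are `K`-spaces. -/
  sober : ∀ (S : Type u) [TopologicalSpace S] [T0Space S] [QuasiSober S], K S
  /-- In a sober space, the intersection of any family of `K`-subspaces is a `K`-subspace. -/
  sInter : ∀ (S : Type u) [TopologicalSpace S] [T0Space S] [QuasiSober S] (F : Set (Set S)),
    (∀ A ∈ F, K A) → K (⋂₀ F : Set S)
  /-- Preimages of `K`-subspaces under continuous maps of sober spaces are `K`-subspaces. -/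
  preimage : ∀ (S T : Type u) [TopologicalSpace S] [T0Space S] [QuasiSober S]
    [TopologicalSpace T] [T0Space T] [QuasiSober T] (f : S → T), Continuous f →
    ∀ B : Set T, K B → K (f ⁻¹' B)

/-- The intersection of all `K`-subspaces of `S` that contain `A`. If `S` is sober and `K` is a
`K`-category, then it is the smallest `K`-subspace of `S` that contains `A`. -/
def kClosure (K : ∀ (Y : Type u) [TopologicalSpace Y], Prop) {S : Type u} [TopologicalSpace S]
    (A : Set S) : Set S :=
  ⋂₀ {B : Set S | A ⊆ B ∧ K B}

/-- The pair `(Y, g)` is a `K`-completion of `X`. -/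
structure IsKCompletion (K : ∀ (Y : Type u) [TopologicalSpace Y], Prop) {X Y : Type u}
    [TopologicalSpace X] [TopologicalSpace Y] (g : X → Y) : Prop where
  isKSpace : K Y
  isEmbedding : IsEmbedding g
  existsUnique_extension : ∀ (Z : Type u) [TopologicalSpace Z], K Z →
    ∀ f : C(X, Z), ∃! h : C(Y, Z), ∀ x, h (g x) = f x

/-- The underlying set of the space `V_K X`: the smallest `K`-subspace of the extended
probabilistic powerdomain of `X` that contains all simple valuations. -/
noncomputable def kValuations (K : ∀ (Y : Type u) [TopologicalSpace Y], Prop) (X : Type u)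
    [TopologicalSpace X] : Set (ContinuousValuation X) :=
  kClosure K (simpleValuations X : Set (ContinuousValuation X))

theorem simpleValuations_subset_kValuations (K : ∀ (Y : Type u) [TopologicalSpace Y], Prop)
    (X : Type u) [TopologicalSpace X] :
    (simpleValuations X : Set (ContinuousValuation X)) ⊆ kValuations K X :=
  fun _ hμ _ hB => hB.1 hμ

/-! The proof has a topological and an algebraic half.

Topologically, the space of all continuous valuations is sober, and in a sober space the `K`-closure
of a subset `A` is its `K`-completion. A `K`-space `Z` embeds in a power of the Sierpinski space,
and maps into such powers extend from subspaces; the preimage of the embedded `Z` is a `K`-subspace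
containing `A`, so it contains the closure (`IsKCategory.exists_extension`). Extensions are unique
because equalizers of maps from a sober space to a `T₀` space are sober (`quasiSober_equalizer`).
Uniqueness, used in one variable at a time, carries linearity from the simple valuations over to
their closure.

Algebraically, `f` must extend from Dirac masses to simple valuations. If `∑ t j • dirac (y j)` is
close to `∑ r i • dirac (x i)`, a Hall-type transport (`exists_nnreal_transport`) assigns to each `x
i` at least a fixed fraction `c < 1` of its mass, taken from points `y j` near `x i`. Small convex
neighbourhoods turn each portion of `∑ t j • f (y j)` into a multiple of one point near `f (x i)`.
The leftover mass is harmless, since open sets of a topological cone absorb addition. This estimate,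
`ContinuousValuation.exists_isOpen_sum_smul_mem`, yields both well-definedness and continuity. -/

/-! ### Sober spaces -/

/-- A space is quasi-sober if every irreducible set `F` has a point that lies in exactly those
subbasic open sets that `F` meets. -/
theorem quasiSober_of_generateFrom {S : Type*} [t : TopologicalSpace S] {B : Set (Set S)}
    (hB : t = generateFrom B)
    (h : ∀ F : Set S, IsIrreducible F → ∃ s, ∀ b ∈ B, s ∈ b ↔ (F ∩ b).Nonempty) :
    QuasiSober S where
  sober := by
    intro F hF hFc
    obtain ⟨s, hs⟩ := h F hF
    refine ⟨s, isGenericPoint_iff_specializes.2 fun x => ⟨fun hx => ?_, fun hx => ?_⟩⟩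
    · refine hx.mem_closed hFc ?_
      rw [← hFc.closure_eq, (isTopologicalBasis_of_subbasis hB).mem_closure_iff]
      rintro _ ⟨f, ⟨hf, hfB⟩, rfl⟩ hsf
      -- An irreducible set that meets finitely many open sets meets their intersection, so subbasic
      -- sets suffice to test the closure.
      have := isIrreducible_iff_sInter.1 hF hf.toFinset
        (fun b hb => by
          rw [hB]; exact isOpen_generateFrom_of_mem (hfB (hf.mem_toFinset.1 hb)))
        (fun b hb => (hs b (hfB (hf.mem_toFinset.1 hb))).1 (hsf b (hf.mem_toFinset.1 hb)))
      rwa [hf.coe_toFinset, Set.inter_comm] at this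
    · rw [Specializes, hB, nhds_generateFrom, nhds_generateFrom]
      exact le_iInf₂ fun b hb => iInf₂_le b ⟨(hs b hb.2).2 ⟨x, hx, hb.1⟩, hb.2⟩

/-- Powers of the Sierpinski space are sober. -/
theorem quasiSober_pi_prop (I : Type*) : QuasiSober (I → Prop) := by
  refine quasiSober_of_generateFrom (B := Set.range fun i => {p : I → Prop | p i}) ?_ ?_
  · refine le_antisymm (le_generateFrom ?_) ?_
    · rintro _ ⟨i, rfl⟩
      exact isOpen_iff_continuous_mem.2 (continuous_apply i)
    · refine le_iInf fun i => continuous_iff_le_induced.1 ?_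
      let := generateFrom (Set.range fun i => {p : I → Prop | p i})
      have hi : IsOpen {p : I → Prop | p i} := isOpen_generateFrom_of_mem ⟨i, rfl⟩
      exact isOpen_iff_continuous_mem.1 hi
  · intro F _
    refine ⟨fun i => ∃ p ∈ F, p i, ?_⟩
    rintro _ ⟨i, rfl⟩
    rfl

/-- The equalizer of two continuous maps from a quasi-sober space to a `T₀` space is
quasi-sober. -/
theorem quasiSober_equalizer {S T : Type*} [TopologicalSpace S] [QuasiSober S]
    [TopologicalSpace T] [T0Space T] {f g : S → T} (hf : Continuous f) (hg : Continuous g) :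
    QuasiSober {s | f s = g s} where
  sober := by
    intro F hF hFc
    have hi : IsIrreducible ((↑) '' F : Set S) := hF.image _ continuous_subtype_val.continuousOn
    obtain ⟨s, hs⟩ := QuasiSober.sober hi.closure isClosed_closure
    have hfs := hs.image hf
    have hgs := hs.image hg
    rw [closure_image_closure hf] at hfs
    rw [closure_image_closure hg] at hgs
    -- Since `f` and `g` agree on `F`, the points `f s` and `g s` are generic in the same closed
    -- set, so they coincide in a `T₀` space.
    have himg : f '' ((↑) '' F) = g '' ((↑) '' F) := by
      refine Set.image_congr ?_
      rintro _ ⟨x, -, rfl⟩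
      exact x.2
    rw [himg] at hfs
    refine ⟨⟨s, hfs.eq hgs⟩, ?_⟩
    rw [IsGenericPoint, IsEmbedding.subtypeVal.closure_eq_preimage_closure_image,
      Set.image_singleton, hs.def, ← IsEmbedding.subtypeVal.closure_eq_preimage_closure_image,
      hFc.closure_eq]

/-- A continuous map to a power of the Sierpinski space extends along every embedding. -/
theorem exists_continuous_extension_pi_prop {S I : Type*} [TopologicalSpace S] {A : Set S}
    {f : A → I → Prop} (hf : Continuous f) :
    ∃ F : S → I → Prop, Continuous F ∧ ∀ a : A, F a = f a := by
  have hopen (i : I) : IsOpen {a : A | f a i} :=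
    isOpen_iff_continuous_mem.2 ((continuous_apply i).comp hf)
  -- Each coordinate of `f` is an open subset of `A`, hence the trace of an open set of `S`, which
  -- serves as the extended coordinate.
  choose U hU hUA using fun i => isOpen_induced_iff.1 (hopen i)
  refine ⟨fun s i => s ∈ U i, continuous_pi fun i => isOpen_iff_continuous_mem.1 (hU i), ?_⟩
  intro a
  funext i
  have := Set.ext_iff.1 (hUA i) a
  exact propext this

/-! ### `K`-closures -/

section KClosure

variable {K : ∀ (Y : Type u) [TopologicalSpace Y], Prop} {S : Type u} [TopologicalSpace S]

theorem subset_kClosure (A : Set S) : A ⊆ kClosure K A :=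
  fun _ ha _ hB => hB.1 ha

theorem kClosure_subset {A B : Set S} (h : A ⊆ B) (hB : K B) : kClosure K A ⊆ B :=
  fun _ hx => hx B ⟨h, hB⟩

theorem IsKCategory.isKSpace_kClosure (hK : IsKCategory K) [T0Space S] [QuasiSober S] (A : Set S) :
    K (kClosure K A) :=
  hK.sInter S _ fun _ hB => hB.2

/-- `K`-closures are respected by continuous maps between sober spaces. -/
theorem IsKCategory.mapsTo_kClosure (hK : IsKCategory K) [T0Space S] [QuasiSober S] {T : Type u}
    [TopologicalSpace T] [T0Space T] [QuasiSober T] {f : S → T} (hf : Continuous f) {A : Set S}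
    {B : Set T} (h : Set.MapsTo f A (kClosure K B)) :
    Set.MapsTo f (kClosure K A) (kClosure K B) :=
  kClosure_subset (B := f ⁻¹' kClosure K B) h (hK.preimage S T f hf _ (hK.isKSpace_kClosure B))

/-- A continuous map from a subset `A` of a sober space to a `K`-space extends to the
`K`-closure of `A`. -/
theorem IsKCategory.exists_extension (hK : IsKCategory K) [T0Space S] [QuasiSober S] {A : Set S}
    {Z : Type u} [TopologicalSpace Z] (hZ : K Z) (f : C(A, Z)) :
    ∃ h : C(kClosure K A, Z), ∀ a, h (Set.inclusion (subset_kClosure A) a) = f a := by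
  have := hK.t0 Z hZ
  have := quasiSober_pi_prop (Opens Z)
  have he := productOfMemOpens_isEmbedding Z
  obtain ⟨F, hF, hFA⟩ := exists_continuous_extension_pi_prop (he.continuous.comp f.continuous)
  have hR : K (Set.range (productOfMemOpens Z)) := hK.homeomorph _ _ ⟨he.toHomeomorph⟩ hZ
  have hsub : kClosure K A ⊆ F ⁻¹' Set.range (productOfMemOpens Z) :=
    kClosure_subset (fun a ha => ⟨f ⟨a, ha⟩, (hFA ⟨a, ha⟩).symm⟩) (hK.preimage _ _ F hF _ hR)
  have hc : Continuous fun x : kClosure K A =>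
      (⟨F x, hsub x.2⟩ : Set.range (productOfMemOpens Z)) :=
    (hF.comp continuous_subtype_val).subtype_mk _
  refine ⟨⟨fun x => he.toHomeomorph.symm ⟨F x, hsub x.2⟩,
    he.toHomeomorph.symm.continuous.comp hc⟩, fun a => ?_⟩
  refine (Homeomorph.symm_apply_eq _).2 (Subtype.ext ?_)
  exact hFA a

/-- Continuous maps from the `K`-closure of a subset `A` of a sober space to a `T₀` space that
agree on `A` are equal. -/
theorem IsKCategory.eqOn_kClosure (hK : IsKCategory K) [T0Space S] [QuasiSober S] {A : Set S}
    {Z : Type u} [TopologicalSpace Z] [T0Space Z] {g h : kClosure K A → Z}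
    (hg : Continuous g) (hh : Continuous h)
    (hgh : ∀ a, g (Set.inclusion (subset_kClosure A) a) =
      h (Set.inclusion (subset_kClosure A) a)) : g = h := by
  have he := productOfMemOpens_isEmbedding Z
  -- The given maps live only on the closure; extending them to all of `S` makes their equalizer a
  -- sober subspace of `S`, hence a `K`-subspace.
  obtain ⟨G, hG, hGA⟩ := exists_continuous_extension_pi_prop (he.continuous.comp hg)
  obtain ⟨H, hH, hHA⟩ := exists_continuous_extension_pi_prop (he.continuous.comp hh)
  have := quasiSober_equalizer hG hH
  have hE : K {s | G s = H s} := hK.sober _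
  have hsub : kClosure K A ⊆ {s | G s = H s} := by
    refine kClosure_subset (fun a ha => ?_) hE
    have h₁ := hGA (Set.inclusion (subset_kClosure A) ⟨a, ha⟩)
    have h₂ := hHA (Set.inclusion (subset_kClosure A) ⟨a, ha⟩)
    simp only [Function.comp_apply, hgh] at h₁ h₂
    exact h₁.trans h₂.symm
  funext x
  exact he.injective ((hGA x).symm.trans ((hsub x.2).trans (hHA x)))

/-- The `K`-closure of a subset of a sober space is its `K`-completion. -/
theorem IsKCategory.isKCompletion_kClosure (hK : IsKCategory K) [T0Space S] [QuasiSober S]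
    (A : Set S) : IsKCompletion K (Set.inclusion (subset_kClosure (K := K) A)) where
  isKSpace := hK.isKSpace_kClosure A
  isEmbedding := IsEmbedding.inclusion _
  existsUnique_extension := by
    intro Z _ hZ f
    have := hK.t0 Z hZ
    obtain ⟨h, hh⟩ := hK.exists_extension hZ f
    refine ⟨h, hh, fun h' hh' => ContinuousMap.ext fun x => ?_⟩
    exact congrFun (hK.eqOn_kClosure h'.continuous h.continuous
      fun a => (hh' a).trans (hh a).symm) x

end KClosure

/-! ### The extended probabilistic powerdomain -/

/-- By continuity of addition, a sum above `c` stays above `c` when both summands are lowered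
slightly. A zero summand cannot be lowered, whence `ha` and `hb`. -/
theorem ENNReal.add_le_of_forall_nnreal_lt {a b c : ℝ≥0∞} (ha : a ≤ c) (hb : b ≤ c)
    (h : ∀ r s : ℝ≥0, (r : ℝ≥0∞) < a → (s : ℝ≥0∞) < b → (r + s : ℝ≥0∞) ≤ c) : a + b ≤ c := by
  refine ENNReal.le_of_forall_nnreal_lt fun r hr => ?_
  by_contra! hc
  have hopen : IsOpen {p : ℝ≥0∞ × ℝ≥0∞ | c < p.1 + p.2} :=
    isOpen_lt continuous_const continuous_add
  rcases eq_or_ne a 0 with rfl | ha0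
  · exact absurd (hc.trans hr) (by simpa using hb)
  rcases eq_or_ne b 0 with rfl | hb0
  · exact absurd (hc.trans hr) (by simpa using ha)
  have : (a, b) ∈ {p : ℝ≥0∞ × ℝ≥0∞ | c < p.1 + p.2} := hc.trans hr
  obtain ⟨U, V, hU, haU, hV, hbV, hUV⟩ := mem_nhds_prod_iff'.1 (hopen.mem_nhds this)
  obtain ⟨x, hx, hxU⟩ := exists_Ioc_subset_of_mem_nhds (hU.mem_nhds haU) ⟨0, pos_iff_ne_zero.2 ha0⟩
  obtain ⟨y, hy, hyV⟩ := exists_Ioc_subset_of_mem_nhds (hV.mem_nhds hbV) ⟨0, pos_iff_ne_zero.2 hb0⟩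
  obtain ⟨s, hs, hsa⟩ := ENNReal.lt_iff_exists_nnreal_btwn.1 hx
  obtain ⟨t, ht, htb⟩ := ENNReal.lt_iff_exists_nnreal_btwn.1 hy
  have hst : c < (s : ℝ≥0∞) + t := hUV (Set.mk_mem_prod (hxU ⟨hs, hsa.le⟩) (hyV ⟨ht, htb.le⟩))
  exact absurd (h s t hsa htb) hst.not_ge

namespace ContinuousValuation

variable {X : Type u} [TopologicalSpace X]

theorem isOpen_setOf_lt (U : Opens X) (r : ℝ≥0) :
    IsOpen {μ : ContinuousValuation X | (r : ℝ≥0∞) < μ U} :=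
  isOpen_generateFrom_of_mem ⟨U, r, rfl⟩

theorem lowerSemicontinuous_apply (U : Opens X) :
    LowerSemicontinuous fun μ : ContinuousValuation X => μ U := by
  rw [lowerSemicontinuous_iff_isOpen_preimage]
  intro c
  induction c with
  | top => simp
  | coe r => exact isOpen_setOf_lt U r

theorem continuous_iff {Y : Type*} [TopologicalSpace Y] {f : Y → ContinuousValuation X} :
    Continuous f ↔ ∀ U, LowerSemicontinuous fun y => f y U := by
  refine ⟨fun hf U => (lowerSemicontinuous_apply U).comp hf, fun h => ?_⟩
  refine continuous_generateFrom_iff.2 ?_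
  rintro _ ⟨U, r, rfl⟩
  exact (lowerSemicontinuous_iff_isOpen_preimage.1 (h U)) r

instance instT0Space : T0Space (ContinuousValuation X) := by
  refine ⟨fun μ ν h => ContinuousValuation.ext (funext fun U => ?_)⟩
  have key (r : ℝ≥0) : (r : ℝ≥0∞) < μ U ↔ (r : ℝ≥0∞) < ν U := h.mem_open_iff (isOpen_setOf_lt U r)
  refine le_antisymm (ENNReal.le_of_forall_nnreal_lt fun r hr => ?_)
    (ENNReal.le_of_forall_nnreal_lt fun r hr => ?_)
  · exact ((key r).1 hr).le
  · exact ((key r).2 hr).le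

/-- The pointwise supremum of an irreducible set of continuous valuations. -/
noncomputable def sSupOfIrreducible (F : Set (ContinuousValuation X)) (hF : IsIrreducible F) :
    ContinuousValuation X where
  toFun U := ⨆ μ : F, μ.1 U
  strict := by simp [strict]
  mono U V h := iSup_mono fun μ => μ.1.mono h
  modular U V := by
    have key (U V U' V' : Opens X) (h : ∀ ξ : ContinuousValuation X, ξ U + ξ V ≤ ξ U' + ξ V') :
        (⨆ μ : F, μ.1 U) + (⨆ μ : F, μ.1 V) ≤ (⨆ μ : F, μ.1 U') + (⨆ μ : F, μ.1 V') := by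
      have h' (ξ : F) : ξ.1 U + ξ.1 V ≤ (⨆ μ : F, μ.1 U') + (⨆ μ : F, μ.1 V') :=
        (h ξ.1).trans (add_le_add (le_iSup (fun μ : F => μ.1 U') ξ)
          (le_iSup (fun μ : F => μ.1 V') ξ))
      refine ENNReal.add_le_of_forall_nnreal_lt ?_ ?_ fun r s hr hs => ?_
      · exact iSup_le fun ξ => le_self_add.trans (h' ξ)
      · exact iSup_le fun ξ => le_add_self.trans (h' ξ)
      obtain ⟨μ, hμ⟩ := lt_iSup_iff.1 hr
      obtain ⟨ν, hν⟩ := lt_iSup_iff.1 hs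
      -- Irreducibility plays the role of directedness: one member of `F` exceeds `r` on `U` and `s`
      -- on `V` simultaneously.
      obtain ⟨ξ, hξ, hξr, hξs⟩ := hF.2 _ _ (isOpen_setOf_lt U r) (isOpen_setOf_lt V s)
        ⟨μ.1, μ.2, hμ⟩ ⟨ν.1, ν.2, hν⟩
      exact (add_le_add hξr.le hξs.le).trans (h' ⟨ξ, hξ⟩)
    exact le_antisymm (key _ _ _ _ fun ξ => (ξ.modular U V).le)
      (key _ _ _ _ fun ξ => (ξ.modular U V).ge)
  scott := by
    intro d hne hd a ha
    refine ⟨?_, fun b hb => iSup_le fun μ => (μ.1.scott hne hd ha).2 ?_⟩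
    · rintro _ ⟨U, hU, rfl⟩
      exact iSup_mono fun μ => μ.1.mono (ha.1 hU)
    · rintro _ ⟨U, hU, rfl⟩
      exact (le_iSup (fun μ : F => μ.1 U) μ).trans (hb ⟨U, hU, rfl⟩)

instance instQuasiSober : QuasiSober (ContinuousValuation X) := by
  refine quasiSober_of_generateFrom rfl fun F hF => ⟨sSupOfIrreducible F hF, ?_⟩
  rintro _ ⟨U, r, rfl⟩
  change (r : ℝ≥0∞) < ⨆ μ : F, μ.1 U ↔ _
  rw [lt_iSup_iff]
  exact ⟨fun ⟨μ, hμ⟩ => ⟨μ.1, μ.2, hμ⟩, fun ⟨μ, hμ, h⟩ => ⟨⟨μ, hμ⟩, h⟩⟩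

theorem continuous_add :
    Continuous fun p : ContinuousValuation X × ContinuousValuation X => p.1 + p.2 :=
  continuous_iff.2 fun U => ((lowerSemicontinuous_apply U).comp continuous_fst).add
    ((lowerSemicontinuous_apply U).comp continuous_snd)

end ContinuousValuation

/-- The rays `(r, ∞)` are Scott open. -/
theorem isOpen_withScott_Ioi (r : ℝ≥0) :
    IsOpen {s : WithScott ℝ≥0 | r < WithScott.ofScott s} := by
  rw [IsScott.isOpen_iff_isUpperSet_and_dirSupInaccOn (D := Set.univ), dirSupInaccOn_univ]
  refine ⟨fun a b hab ha => lt_of_lt_of_le ha hab, fun d hne hd a ha har => ?_⟩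
  exact (lt_isLUB_iff (α := ℝ≥0) ha).1 har

namespace ContinuousValuation

variable {X : Type u} [TopologicalSpace X]

theorem continuous_smul :
    Continuous fun p : WithScott ℝ≥0 × ContinuousValuation X => WithScott.ofScott p.1 • p.2 := by
  refine continuous_iff.2 fun U => ?_
  rintro ⟨s, μ⟩ c hc
  change c < ((WithScott.ofScott s : ℝ≥0) : ℝ≥0∞) * μ U at hc
  change ∀ᶠ p : WithScott ℝ≥0 × ContinuousValuation X in 𝓝 (s, μ),
    c < ((WithScott.ofScott p.1 : ℝ≥0) : ℝ≥0∞) * p.2 U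
  generalize hm : μ U = m at hc
  have hs0 : ((WithScott.ofScott s : ℝ≥0) : ℝ≥0∞) ≠ 0 := by rintro h; simp [h] at hc
  -- Choose `b` with `c / s < b < m`, then `r` with `c / b < r < s`; thus `c < r * b`, and both
  -- lower bounds are open conditions.
  rw [mul_comm, ← ENNReal.div_lt_iff (.inl hs0) (.inl ENNReal.coe_ne_top)] at hc
  obtain ⟨b, hb, hbm⟩ := ENNReal.lt_iff_exists_nnreal_btwn.1 hc
  rw [ENNReal.div_lt_iff (.inl hs0) (.inl ENNReal.coe_ne_top)] at hb
  have hb0 : (b : ℝ≥0∞) ≠ 0 := by rintro h; simp [h] at hb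
  rw [mul_comm, ← ENNReal.div_lt_iff (.inl hb0) (.inl ENNReal.coe_ne_top)] at hb
  obtain ⟨r, hr, hrs⟩ := ENNReal.lt_iff_exists_nnreal_btwn.1 hb
  rw [ENNReal.div_lt_iff (.inl hb0) (.inl ENNReal.coe_ne_top)] at hr
  have h₁ : ∀ᶠ t in 𝓝 s, r < WithScott.ofScott t :=
    (isOpen_withScott_Ioi r).mem_nhds (ENNReal.coe_lt_coe.1 hrs)
  have h₂ : ∀ᶠ ν in 𝓝 μ, (b : ℝ≥0∞) < ν U := (isOpen_setOf_lt U b).mem_nhds (hm.symm ▸ hbm :)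
  filter_upwards [h₁.prod_nhds h₂] with p hp
  exact hr.trans_le (mul_le_mul' (ENNReal.coe_le_coe.2 hp.1.le) hp.2.le)

theorem isTopologicalCone : IsTopologicalCone (ContinuousValuation X) :=
  ⟨inferInstance, continuous_add, continuous_smul⟩

theorem convex_setOf_lt (U : Opens X) (r : ℝ≥0) :
    Convex ℝ≥0 {μ : ContinuousValuation X | (r : ℝ≥0∞) < μ U} := by
  intro μ hμ ν hν a b _ _ hab
  change (r : ℝ≥0∞) < (a : ℝ≥0∞) * μ U + (b : ℝ≥0∞) * ν U
  have hmin : (r : ℝ≥0∞) < min (μ U) (ν U) := lt_min hμ hν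
  calc (r : ℝ≥0∞) < min (μ U) (ν U) := hmin
    _ = (a : ℝ≥0∞) * min (μ U) (ν U) + (b : ℝ≥0∞) * min (μ U) (ν U) := by
        rw [← add_mul, ← ENNReal.coe_add, hab, ENNReal.coe_one, one_mul]
    _ ≤ _ := add_le_add (mul_le_mul_right (min_le_left _ _) _)
        (mul_le_mul_right (min_le_right _ _) _)

theorem isWeaklyLocallyConvex : IsWeaklyLocallyConvex (ContinuousValuation X) := by
  intro μ W hW hμ
  obtain ⟨_, ⟨f, ⟨hf, hfB⟩, rfl⟩, hμf, hfW⟩ :=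
    (isTopologicalBasis_of_subbasis rfl).exists_subset_of_mem_open hμ hW
  refine ⟨_, hfW, ?_, convex_sInter fun b hb => ?_⟩
  · exact (hf.isOpen_sInter fun b hb => isOpen_generateFrom_of_mem (hfB hb)).mem_nhds hμf
  · obtain ⟨U, r, rfl⟩ := hfB hb
    exact convex_setOf_lt U r

end ContinuousValuation

/-! ### Subcones -/

section Submodule

variable {C : Type u} [TopologicalSpace C] [AddCommMonoid C] [Module ℝ≥0 C]

theorem IsTopologicalCone.submodule (hC : IsTopologicalCone C) (V : Submodule ℝ≥0 C) :
    IsTopologicalCone V where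
  t0 := have := hC.t0; inferInstance
  continuous_add := (hC.continuous_add.comp
    ((continuous_subtype_val.comp continuous_fst).prodMk
      (continuous_subtype_val.comp continuous_snd))).subtype_mk _
  continuous_smul := (hC.continuous_smul.comp
    (continuous_fst.prodMk (continuous_subtype_val.comp continuous_snd))).subtype_mk _

theorem IsWeaklyLocallyConvex.submodule (hC : IsWeaklyLocallyConvex C) (V : Submodule ℝ≥0 C) :
    IsWeaklyLocallyConvex V := by
  intro x U hU hx
  obtain ⟨W, hW, rfl⟩ := isOpen_induced_iff.1 hU
  obtain ⟨A, hAW, hA, hconv⟩ := hC x W hW hx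
  exact ⟨(↑) ⁻¹' A, Set.preimage_mono hAW, Filter.mem_map.1 (continuous_subtype_val.continuousAt hA),
    hconv.linear_preimage V.subtype⟩

end Submodule

/-! ### A splitting lemma -/

/-- An integral transport lemma: Hall's marriage theorem with multiplicities. -/
theorem exists_nat_transport {ι κ : Type*} [Fintype ι] [Fintype κ] [DecidableEq κ]
    (n : ι → ℕ) (m : κ → ℕ) (N : ι → Finset κ)
    (h : ∀ A : Finset ι, ∑ i ∈ A, n i ≤ ∑ j ∈ A.biUnion N, m j) :
    ∃ w : ι → κ → ℕ, (∀ i j, w i j ≠ 0 → j ∈ N i) ∧ (∀ i, ∑ j, w i j = n i) ∧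
      ∀ j, ∑ i, w i j ≤ m j := by
  classical
  -- Consumer `i` is split into `n i` unit copies and supplier `j` into `m j`; copies are then
  -- matched.
  let T : (Σ i, Fin (n i)) → Finset (Σ j, Fin (m j)) := fun x => (N x.1).sigma fun _ => .univ
  have hT : ∀ A : Finset (Σ i, Fin (n i)), A.card ≤ (A.biUnion T).card := by
    intro A
    -- Adding all copies of the consumers in `A` leaves the neighbours unchanged, so Hall's
    -- condition reduces to `h`.
    have h₁ : A ⊆ (A.image Sigma.fst).sigma fun _ => .univ := fun x hx => by
      simpa using ⟨x.2, hx⟩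
    have h₂ : A.biUnion T = ((A.image Sigma.fst).biUnion N).sigma fun _ => .univ := by
      ext y
      simp [T]
    calc A.card ≤ _ := Finset.card_le_card h₁
      _ = ∑ i ∈ A.image Sigma.fst, n i := by simp [Finset.card_sigma]
      _ ≤ _ := h _
      _ = _ := by rw [h₂]; simp [Finset.card_sigma]
  obtain ⟨f, hf, hfT⟩ := (Finset.all_card_le_biUnion_card_iff_exists_injective T).1 hT
  have hfN (x : Σ i, Fin (n i)) : (f x).1 ∈ N x.1 := by simpa [T] using hfT x
  refine ⟨fun i j => (Finset.univ.filter fun x : Fin (n i) => (f ⟨i, x⟩).1 = j).card, ?_, ?_, ?_⟩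
  · intro i j hij
    obtain ⟨x, hx⟩ := Finset.card_ne_zero.1 hij
    rw [← (Finset.mem_filter.1 hx).2]
    exact hfN ⟨i, x⟩
  · intro i
    rw [← Finset.card_eq_sum_card_fiberwise (fun _ _ => Finset.mem_coe.2 (Finset.mem_univ _))]
    simp
  · intro j
    calc ∑ i, (Finset.univ.filter fun x : Fin (n i) => (f ⟨i, x⟩).1 = j).card
        = (Finset.univ.sigma fun i =>
            Finset.univ.filter fun x : Fin (n i) => (f ⟨i, x⟩).1 = j).card := by
          rw [Finset.card_sigma]
      _ = ((Finset.univ.sigma fun i =>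
            Finset.univ.filter fun x : Fin (n i) => (f ⟨i, x⟩).1 = j).image f).card :=
          (Finset.card_image_of_injective _ hf).symm
      _ ≤ (({j} : Finset κ).sigma fun j => (Finset.univ : Finset (Fin (m j)))).card := by
          refine Finset.card_le_card fun y hy => ?_
          simp only [Finset.mem_image, Finset.mem_sigma, Finset.mem_filter] at hy
          obtain ⟨x, hx, rfl⟩ := hy
          simpa using hx.2.2
      _ = m j := by simp [Finset.card_sigma]

/-- A transport lemma: if the demand of every nonempty set of consumers is strictly less than the
supply of their neighbours, then all demands can be met. -/
theorem exists_nnreal_transport {ι κ : Type*} [Fintype ι] [Fintype κ] [DecidableEq κ]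
    (s : ι → ℝ≥0) (t : κ → ℝ≥0) (N : ι → Finset κ)
    (h : ∀ A : Finset ι, A.Nonempty → ∑ i ∈ A, s i < ∑ j ∈ A.biUnion N, t j) :
    ∃ w : ι → κ → ℝ≥0, (∀ i j, w i j ≠ 0 → j ∈ N i) ∧ (∀ i, s i ≤ ∑ j, w i j) ∧
      ∀ j, ∑ i, w i j ≤ t j := by
  classical
  -- After scaling by `M`, the strict surplus must outweigh the rounding errors, at most one unit
  -- per consumer and per supplier.
  have key : ∀ᶠ M : ℕ in Filter.atTop, ∀ A : Finset ι, A.Nonempty →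
      (Fintype.card ι + Fintype.card κ : ℝ) ≤
        M * ((∑ j ∈ A.biUnion N, t j : ℝ) - ∑ i ∈ A, (s i : ℝ)) := by
    rw [Filter.eventually_all]
    intro A
    by_cases hA : A.Nonempty
    · have hpos : (0 : ℝ) < (∑ j ∈ A.biUnion N, t j : ℝ) - ∑ i ∈ A, (s i : ℝ) :=
        sub_pos.2 (by exact_mod_cast h A hA)
      have := (tendsto_natCast_atTop_atTop (R := ℝ)).atTop_mul_const hpos
      filter_upwards [this.eventually_ge_atTop (Fintype.card ι + Fintype.card κ : ℝ)] with M hM _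
      exact hM
    · exact Filter.Eventually.of_forall fun _ h => absurd h hA
  obtain ⟨M, hM, hM0⟩ := (key.and (Filter.eventually_gt_atTop 0)).exists
  have hM0' : (M : ℝ≥0) ≠ 0 := by exact_mod_cast hM0.ne'
  -- Demands are rounded up and supplies down, so dividing the integral solution by `M` preserves
  -- both bounds.
  obtain ⟨w, hwN, hws, hwt⟩ := exists_nat_transport (fun i => ⌈M * s i⌉₊) (fun j => ⌊M * t j⌋₊) N
    (by
      intro A
      rcases A.eq_empty_or_nonempty with rfl | hA
      · simp
      have h₁ : ((∑ i ∈ A, ⌈M * s i⌉₊ : ℕ) : ℝ) ≤ ∑ i ∈ A, ((M : ℝ) * s i + 1) := by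
        push_cast
        refine Finset.sum_le_sum fun i _ => ?_
        have := (Nat.ceil_lt_add_one (zero_le (a := M * s i))).le
        exact_mod_cast this
      have h₂ : ∑ j ∈ A.biUnion N, ((M : ℝ) * t j - 1) ≤
          ((∑ j ∈ A.biUnion N, ⌊M * t j⌋₊ : ℕ) : ℝ) := by
        push_cast
        refine Finset.sum_le_sum fun j _ => ?_
        have := (Nat.lt_floor_add_one (M * t j)).le
        rw [sub_le_iff_le_add]
        exact_mod_cast this
      have h₃ := hM A hA
      have hι : (A.card : ℝ) ≤ Fintype.card ι := by exact_mod_cast A.card_le_univ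
      have hκ : ((A.biUnion N).card : ℝ) ≤ Fintype.card κ := by
        exact_mod_cast (A.biUnion N).card_le_univ
      rw [Finset.sum_add_distrib, ← Finset.mul_sum] at h₁
      rw [Finset.sum_sub_distrib, ← Finset.mul_sum] at h₂
      simp only [Finset.sum_const, nsmul_eq_mul, mul_one] at h₁ h₂
      have : ((∑ i ∈ A, ⌈M * s i⌉₊ : ℕ) : ℝ) ≤ ((∑ j ∈ A.biUnion N, ⌊M * t j⌋₊ : ℕ) : ℝ) := by
        linarith
      exact_mod_cast this)
  refine ⟨fun i j => w i j / M, fun i j hij => hwN i j ?_, fun i => ?_, fun j => ?_⟩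
  · rintro h0
    simp [h0] at hij
  · rw [← Finset.sum_div, le_div_iff₀ (pos_iff_ne_zero.2 hM0'), ← Nat.cast_sum, hws, mul_comm]
    exact Nat.le_ceil _
  · rw [← Finset.sum_div, div_le_iff₀ (pos_iff_ne_zero.2 hM0'), ← Nat.cast_sum, mul_comm (t j)]
    exact (Nat.cast_le.2 (hwt j)).trans (Nat.floor_le zero_le)

/-! ### The free weakly locally convex cone -/

/-- A nontrivial combination, with nonnegative real coefficients, of points of a convex set is a
multiple of a point of that set. -/
theorem Convex.exists_sum_smul_eq {C κ : Type*} [AddCommMonoid C] [Module ℝ≥0 C] {A : Set C}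
    (hA : Convex ℝ≥0 A) (w : κ → ℝ≥0) (z : κ → C) (J : Finset κ)
    (hz : ∀ j ∈ J, w j ≠ 0 → z j ∈ A) (hw : ∑ j ∈ J, w j ≠ 0) :
    ∃ a ∈ A, ∑ j ∈ J, w j • z j = (∑ j ∈ J, w j) • a := by
  classical
  induction J using Finset.induction_on with
  | empty => simp at hw
  | insert j J hj ih =>
    rw [Finset.sum_insert hj] at hw
    rw [Finset.sum_insert hj, Finset.sum_insert hj]
    have hz' : ∀ i ∈ J, w i ≠ 0 → z i ∈ A := fun i hi => hz i (Finset.mem_insert_of_mem hi)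
    rcases eq_or_ne (∑ j ∈ J, w j) 0 with h0 | h0
    · rw [h0, add_zero] at hw
      refine ⟨z j, hz j (Finset.mem_insert_self _ _) hw, ?_⟩
      rw [h0, add_zero, Finset.sum_eq_zero, add_zero]
      intro i hi
      rw [Finset.sum_eq_zero_iff.1 h0 i hi, zero_smul]
    · obtain ⟨a, ha, hs⟩ := ih hz' h0
      rcases eq_or_ne (w j) 0 with hj0 | hj0
      · exact ⟨a, ha, by rw [hs, hj0, zero_smul, zero_add, zero_add]⟩
      · set t := ∑ j ∈ J, w j
        refine ⟨(w j / (w j + t)) • z j + (t / (w j + t)) • a,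
          hA (hz j (Finset.mem_insert_self _ _) hj0) ha zero_le zero_le ?_, ?_⟩
        · rw [← add_div, div_self hw]
        · rw [hs, smul_add, smul_smul, smul_smul, mul_div_cancel₀ _ hw, mul_div_cancel₀ _ hw]

/-! ### Open sets in topological cones -/

namespace IsTopologicalCone

variable {C : Type u} [TopologicalSpace C] [AddCommMonoid C] [Module ℝ≥0 C]

theorem continuous_smul_const (hC : IsTopologicalCone C) (x : C) :
    Continuous fun r : WithScott ℝ≥0 => WithScott.ofScott r • x :=
  hC.continuous_smul.comp (continuous_id.prodMk continuous_const)

theorem continuous_const_smul (hC : IsTopologicalCone C) (r : ℝ≥0) :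
    Continuous fun x : C => r • x :=
  hC.continuous_smul.comp
    ((continuous_const (y := WithScott.toScott r)).prodMk continuous_id)

/-- Open sets are upper sets for the algebraic preorder. -/
theorem add_mem_of_isOpen (hC : IsTopologicalCone C) {W : Set C} (hW : IsOpen W) {x : C}
    (hx : x ∈ W) (z : C) : x + z ∈ W := by
  -- The ray runs from `x` at `r = 0` to `x + z` at `r = 1`, and Scott open sets are upper sets.
  have hc : Continuous fun r : WithScott ℝ≥0 => x + WithScott.ofScott r • z :=
    hC.continuous_add.comp (continuous_const.prodMk (hC.continuous_smul_const z))
  have hup := IsScott.isUpperSet_of_isOpen (D := Set.univ) (hW.preimage hc)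
  have := hup (a := WithScott.toScott 0) (b := WithScott.toScott 1)
    (show (0 : ℝ≥0) ≤ 1 from zero_le) (by simpa using hx)
  simpa using this

/-- The scalar `1` is the directed supremum of `(0, 1)`, so a Scott open set containing `1` meets
that interval. The factor `c` supplies the strict inequalities needed for transport. -/
theorem exists_smul_mem_of_isOpen (hC : IsTopologicalCone C) {W : Set C} (hW : IsOpen W) {x : C}
    (hx : x ∈ W) : ∃ c : ℝ≥0, 0 < c ∧ c < 1 ∧ c • x ∈ W := by
  have ho := hW.preimage (hC.continuous_smul_const x)
  rw [IsScott.isOpen_iff_isUpperSet_and_dirSupInaccOn (D := Set.univ), dirSupInaccOn_univ] at ho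
  have hd : DirectedOn (· ≤ ·) (Set.Ioo (0 : ℝ≥0) 1) := fun a ha b hb =>
    ⟨max a b, ⟨lt_max_of_lt_left ha.1, max_lt ha.2 hb.2⟩, le_max_left a b, le_max_right a b⟩
  have hinacc : DirSupInacc (α := ℝ≥0) {r | r • x ∈ W} := ho.2
  obtain ⟨c, hc, hcx⟩ := hinacc (Set.nonempty_Ioo.2 zero_lt_one) hd (isLUB_Ioo zero_lt_one)
    (show (1 : ℝ≥0) • x ∈ W by simpa using hx)
  exact ⟨c, hc.1, hc.2, hcx⟩

theorem exists_isOpen_sum_smul_mem (hC : IsTopologicalCone C) {ι : Type*} [Fintype ι]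
    (s : ι → ℝ≥0) (z : ι → C) {W : Set C} (hW : IsOpen W) (hz : ∑ i, s i • z i ∈ W) :
    ∃ V : ι → Set C, (∀ i, IsOpen (V i) ∧ z i ∈ V i) ∧
      ∀ a : ι → C, (∀ i, a i ∈ V i) → ∑ i, s i • a i ∈ W := by
  have : ContinuousAdd C := ⟨hC.continuous_add⟩
  have hc : Continuous fun a : ι → C => ∑ i, s i • a i :=
    continuous_finsetSum _ fun i _ => (hC.continuous_const_smul (s i)).comp (continuous_apply i)
  obtain ⟨V, hV, hVW⟩ := isOpen_pi_iff'.1 (hW.preimage hc) z hz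
  exact ⟨V, hV, fun a ha => hVW fun i _ => ha i⟩

end IsTopologicalCone

/-! ### Extension from points to simple valuations -/

namespace ContinuousValuation

variable {X : Type u} [TopologicalSpace X]

theorem sum_apply {ι : Type*} (J : Finset ι) (μ : ι → ContinuousValuation X) (U : Opens X) :
    (∑ i ∈ J, μ i) U = ∑ i ∈ J, μ i U := by
  classical
  induction J using Finset.induction_on with
  | empty => simp
  | insert j J hj ih => rw [Finset.sum_insert hj, Finset.sum_insert hj, add_apply, ih]

open Classical in
theorem dirac_apply (x : X) (U : Opens X) : dirac x U = if x ∈ U then 1 else 0 := rfl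

open Classical in
theorem sum_smul_dirac_apply {ι : Type*} [Fintype ι] (r : ι → ℝ≥0) (x : ι → X) (U : Opens X) :
    (∑ i, r i • dirac (x i)) U = ((∑ i with x i ∈ U, r i : ℝ≥0) : ℝ≥0∞) := by
  rw [sum_apply, Finset.sum_filter, ENNReal.ofNNReal_finsetSum]
  refine Finset.sum_congr rfl fun i _ => ?_
  rw [smul_apply, dirac_apply]
  split_ifs <;> simp

/-- Every open neighbourhood of a combination of values of `f` contains the corresponding
combinations for all simple valuations in a neighbourhood of the given one. -/
theorem exists_isOpen_sum_smul_mem {C : Type u} [TopologicalSpace C] [AddCommMonoid C]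
    [Module ℝ≥0 C] (hC : IsTopologicalCone C) (hC' : IsWeaklyLocallyConvex C) (f : C(X, C))
    {ι : Type*} [Fintype ι] (r : ι → ℝ≥0) (hr : ∀ i, r i ≠ 0) (x : ι → X) {W : Set C}
    (hW : IsOpen W) (hx : ∑ i, r i • f (x i) ∈ W) :
    ∃ O : Set (ContinuousValuation X), IsOpen O ∧ ∑ i, r i • dirac (x i) ∈ O ∧
      ∀ {κ : Type u} [Fintype κ] (t : κ → ℝ≥0) (y : κ → X),
        ∑ j, t j • dirac (y j) ∈ O → ∑ j, t j • f (y j) ∈ W := by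
  classical
  obtain ⟨c, hc0, hc1, hcx⟩ := hC.exists_smul_mem_of_isOpen hW hx
  simp only [Finset.smul_sum, smul_smul] at hcx
  obtain ⟨V, hV, hVW⟩ := hC.exists_isOpen_sum_smul_mem _ _ hW hcx
  choose A hAV hAn hAc using fun i => hC' (f (x i)) (V i) (hV i).1 (hV i).2
  let U (i : ι) : Opens X := ⟨f ⁻¹' interior (A i), isOpen_interior.preimage f.continuous⟩
  have hxU (i : ι) : x i ∈ U i := mem_interior_iff_mem_nhds.2 (hAn i)
  have hmem (B : Finset ι) (z : X) : z ∈ B.sup U ↔ ∃ i ∈ B, z ∈ U i := by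
    simp [Finset.sup_eq_iSup]
  -- The set `O` encodes the Hall condition: for each nonempty `B`, the mass on the union of the `U
  -- i` with `i ∈ B` exceeds the reduced demand of `B`.
  refine ⟨⋂ B : {B : Finset ι // B.Nonempty},
    {μ | ((∑ i ∈ B.1, c * r i : ℝ≥0) : ℝ≥0∞) < μ (B.1.sup U)},
    isOpen_iInter_of_finite fun B => isOpen_setOf_lt _ _, Set.mem_iInter.2 fun B => ?_,
    fun {κ} _ t y hty => ?_⟩
  · change ((∑ i ∈ B.1, c * r i : ℝ≥0) : ℝ≥0∞) < _
    rw [sum_smul_dirac_apply, ENNReal.coe_lt_coe]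
    calc ∑ i ∈ B.1, c * r i < ∑ i ∈ B.1, r i :=
          Finset.sum_lt_sum_of_nonempty B.2 fun i _ =>
            mul_lt_of_lt_one_left (pos_iff_ne_zero.2 (hr i)) hc1
      _ ≤ _ := Finset.sum_le_sum_of_subset fun i hi => by
          simpa using (hmem _ _).2 ⟨i, hi, hxU i⟩
  · obtain ⟨w, hwN, hws, hwt⟩ := exists_nnreal_transport (fun i => c * r i) t
      (fun i => Finset.univ.filter fun j => y j ∈ U i) (by
        intro B hB
        have h := Set.mem_iInter.1 hty ⟨B, hB⟩
        change ((∑ i ∈ B, c * r i : ℝ≥0) : ℝ≥0∞) < _ at h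
        rw [sum_smul_dirac_apply, ENNReal.coe_lt_coe] at h
        convert h using 2
        ext j
        simp [hmem])
    have hw0 (i : ι) : ∑ j, w i j ≠ 0 := fun h0 =>
      mul_ne_zero hc0.ne' (hr i) (nonpos_iff_eq_zero.1 (h0 ▸ hws i))
    -- The portion sent to `i` has its normalized barycentre `a i` in `A i`, which need not be open
    -- but lies in `V i`.
    choose a haA ha using fun i => (hAc i).exists_sum_smul_eq (w i) (fun j => f (y j))
      Finset.univ (fun j _ hj => by
        have := hwN i j hj
        exact interior_subset (Finset.mem_filter.1 this).2) (hw0 i)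
    -- The last two sums collect deliveries beyond the demand and unused supply; adding them cannot
    -- leave `W`.
    have h₁ : ∑ j, t j • f (y j) = (∑ i, (c * r i) • a i) +
        ((∑ i, (∑ j, w i j - c * r i) • a i) + ∑ j, (t j - ∑ i, w i j) • f (y j)) := by
      rw [← add_assoc, ← Finset.sum_add_distrib]
      have h₂ (i : ι) : (c * r i) • a i + (∑ j, w i j - c * r i) • a i =
          ∑ j, w i j • f (y j) := by
        rw [← add_smul, add_tsub_cancel_of_le (hws i), ha]
      simp_rw [h₂]
      rw [Finset.sum_comm, ← Finset.sum_add_distrib]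
      refine Finset.sum_congr rfl fun j _ => ?_
      rw [← Finset.sum_smul, ← add_smul, add_tsub_cancel_of_le (hwt j)]
    rw [h₁]
    exact hC.add_mem_of_isOpen hW (hVW a fun i => hAV i (haA i)) _

theorem exists_isOpen_linearCombination_mem {C : Type u} [TopologicalSpace C] [AddCommMonoid C]
    [Module ℝ≥0 C] (hC : IsTopologicalCone C) (hC' : IsWeaklyLocallyConvex C) (f : C(X, C))
    (p : X →₀ ℝ≥0) {W : Set C} (hW : IsOpen W) (hp : Finsupp.linearCombination ℝ≥0 f p ∈ W) :
    ∃ O : Set (ContinuousValuation X), IsOpen O ∧ Finsupp.linearCombination ℝ≥0 dirac p ∈ O ∧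
      ∀ q : X →₀ ℝ≥0, Finsupp.linearCombination ℝ≥0 dirac q ∈ O →
        Finsupp.linearCombination ℝ≥0 f q ∈ W := by
  simp only [Finsupp.linearCombination_apply, Finsupp.sum] at hp ⊢
  rw [← Finset.sum_coe_sort] at hp
  obtain ⟨O, hO, hpO, h⟩ := exists_isOpen_sum_smul_mem hC hC' f (fun i : p.support => p i)
    (fun i => Finsupp.mem_support_iff.1 i.2) (fun i => i) hW hp
  refine ⟨O, hO, ?_, fun q hq => ?_⟩
  · rwa [← Finset.sum_coe_sort]
  · rw [← Finset.sum_coe_sort] at hq ⊢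
    exact h (fun j : q.support => q j) (fun j => j) hq

/-- The space of simple valuations is the free weakly locally convex cone. -/
theorem exists_simpleValuations_lift {C : Type u} [TopologicalSpace C] [AddCommMonoid C]
    [Module ℝ≥0 C] (hC : IsTopologicalCone C) (hC' : IsWeaklyLocallyConvex C) (f : C(X, C)) :
    ∃ F : simpleValuations X →L[ℝ≥0] C,
      ∀ x, F ⟨dirac x, Submodule.subset_span ⟨x, rfl⟩⟩ = f x := by
  have := hC.t0
  let D := Finsupp.linearCombination ℝ≥0 (dirac (X := X))
  let L := Finsupp.linearCombination ℝ≥0 (f : X → C)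
  -- Representations of the same valuation lie in the same sets `O`, so their images are
  -- inseparable, hence equal.
  have hDL (p q : X →₀ ℝ≥0) (h : D p = D q) : L p = L q := by
    refine (inseparable_iff_forall_isOpen.2 fun W hW => ⟨fun hp => ?_, fun hq => ?_⟩).eq
    · obtain ⟨O, -, hpO, hO⟩ := exists_isOpen_linearCombination_mem hC hC' f p hW hp
      exact hO q (h ▸ hpO)
    · obtain ⟨O, -, hqO, hO⟩ := exists_isOpen_linearCombination_mem hC hC' f q hW hq
      exact hO p (h ▸ hqO)
  have hD (μ : simpleValuations X) : ∃ p, D p = μ :=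
    LinearMap.mem_range.1 (by rw [Finsupp.range_linearCombination]; exact μ.2)
  choose P hP using hD
  refine ⟨⟨⟨⟨fun μ => L (P μ), fun μ ν => ?_⟩, fun r μ => ?_⟩, ?_⟩, fun x => ?_⟩
  · rw [← map_add]
    exact hDL _ _ (by rw [map_add, hP, hP, hP, Submodule.coe_add])
  · rw [RingHom.id_apply, ← map_smul]
    exact hDL _ _ (by rw [map_smul, hP, hP, Submodule.coe_smul])
  · refine continuous_iff_continuousAt.2 fun μ => tendsto_nhds.2 fun W hW hμ => ?_
    obtain ⟨O, hO, hμO, h⟩ := exists_isOpen_linearCombination_mem hC hC' f (P μ) hW hμ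
    have hμO' : (μ : ContinuousValuation X) ∈ O := by rw [← hP μ]; exact hμO
    filter_upwards [(hO.preimage continuous_subtype_val).mem_nhds hμO'] with ν hν
    exact h (P ν) (by change D (P ν) ∈ O; rw [hP ν]; exact hν)
  · have := hDL (P ⟨dirac x, Submodule.subset_span ⟨x, rfl⟩⟩) (Finsupp.single x 1)
      (by rw [hP]; simp [D])
    change L _ = _
    rw [this]
    simp [L]

end ContinuousValuation

/-! ### `K`-closures of subcones -/

section KClosureSubmodule

variable {K : ∀ (Y : Type u) [TopologicalSpace Y], Prop} {S : Type u} [TopologicalSpace S]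
  [AddCommMonoid S] [Module ℝ≥0 S] [QuasiSober S]

/-- The `K`-closure of a subcone of a sober topological cone is a subcone. -/
def IsKCategory.kClosureSubmodule (hK : IsKCategory K) (hS : IsTopologicalCone S)
    (A : Submodule ℝ≥0 S) : Submodule ℝ≥0 S where
  carrier := kClosure K (A : Set S)
  zero_mem' := subset_kClosure _ A.zero_mem
  add_mem' := by
    intro x y hx hy
    have := hS.t0
    -- Addition is treated one variable at a time: first with a summand in `A`, then with one in the
    -- closure.
    have h₁ (a : S) (ha : a ∈ A) :
        Set.MapsTo (fun y => a + y) (kClosure K (A : Set S)) (kClosure K (A : Set S)) :=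
      hK.mapsTo_kClosure (hS.continuous_add.comp (continuous_const.prodMk continuous_id))
        fun b hb => subset_kClosure _ (A.add_mem ha hb)
    have h₂ : Set.MapsTo (fun x => x + y) (kClosure K (A : Set S)) (kClosure K (A : Set S)) :=
      hK.mapsTo_kClosure (hS.continuous_add.comp (continuous_id.prodMk continuous_const))
        fun a ha => h₁ a ha hy
    exact h₂ hx
  smul_mem' := by
    intro r x hx
    have := hS.t0
    exact hK.mapsTo_kClosure (hS.continuous_const_smul r)
      (fun a ha => subset_kClosure _ (A.smul_mem r ha)) hx

theorem IsKCategory.le_kClosureSubmodule (hK : IsKCategory K) (hS : IsTopologicalCone S)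
    (A : Submodule ℝ≥0 S) : A ≤ hK.kClosureSubmodule hS A :=
  subset_kClosure (A : Set S)

/-- Continuous linear maps to a `K`-cone extend to the `K`-closure of a subcone. -/
theorem IsKCategory.exists_linear_extension (hK : IsKCategory K) (hS : IsTopologicalCone S)
    (A : Submodule ℝ≥0 S) {C : Type u} [TopologicalSpace C] [AddCommMonoid C] [Module ℝ≥0 C]
    (hC : IsTopologicalCone C) (hKC : K C) (F : A →L[ℝ≥0] C) :
    ∃ G : hK.kClosureSubmodule hS A →L[ℝ≥0] C,
      ∀ a : A, G ⟨a, hK.le_kClosureSubmodule hS A a.2⟩ = F a := by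
  have := hS.t0
  have := hC.t0
  let V := hK.kClosureSubmodule hS A
  obtain ⟨h, hh⟩ := hK.exists_extension (A := (A : Set S)) hKC ⟨F, F.continuous⟩
  let G : V → C := h
  have hG : Continuous G := h.continuous
  have hGA (a : A) : G ⟨a, hK.le_kClosureSubmodule hS A a.2⟩ = F a := hh a
  have hV := hS.submodule V
  -- Additivity spreads from `A` to `V` by uniqueness of extensions in each variable separately.
  have hadd₁ (a : A) (v : V) : G (⟨a, hK.le_kClosureSubmodule hS A a.2⟩ + v) = F a + G v := by
    refine congrFun (hK.eqOn_kClosure (A := (A : Set S))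
      (g := fun v : V => G (⟨a, hK.le_kClosureSubmodule hS A a.2⟩ + v))
      (h := fun v : V => F a + G v) ?_ ?_ fun b => ?_) v
    · exact hG.comp (hV.continuous_add.comp (continuous_const.prodMk continuous_id))
    · exact hC.continuous_add.comp (continuous_const.prodMk hG)
    · exact (hGA (a + b)).trans ((map_add F a b).trans (congrArg _ (hGA b).symm))
  have hadd (u v : V) : G (u + v) = G u + G v := by
    refine congrFun (hK.eqOn_kClosure (A := (A : Set S))
      (g := fun u : V => G (u + v)) (h := fun u : V => G u + G v) ?_ ?_ fun a => ?_) u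
    · exact hG.comp (hV.continuous_add.comp (continuous_id.prodMk continuous_const))
    · exact hC.continuous_add.comp (hG.prodMk continuous_const)
    · exact (hadd₁ a v).trans (congrArg (· + G v) (hGA a).symm)
  have hsmul (r : ℝ≥0) (v : V) : G (r • v) = r • G v := by
    refine congrFun (hK.eqOn_kClosure (A := (A : Set S))
      (g := fun v : V => G (r • v)) (h := fun v : V => r • G v) ?_ ?_ fun a => ?_) v
    · exact hG.comp (hV.continuous_const_smul r)
    · exact (hC.continuous_const_smul r).comp hG
    · exact (hGA (r • a)).trans ((map_smul F r a).trans (congrArg _ (hGA a).symm))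
  exact ⟨⟨⟨⟨G, hadd⟩, hsmul⟩, hG⟩, hGA⟩

end KClosureSubmodule

/-- The free weakly locally convex `K`-cone over `X`. -/
theorem mainTheorem4 (K : ∀ (Y : Type u) [TopologicalSpace Y], Prop) (hK : IsKCategory K)
    (X : Type u) [TopologicalSpace X] [T0Space X] :
    -- `V_K X` is the `K`-completion of the space of simple valuations
    IsKCompletion K (Set.inclusion (simpleValuations_subset_kValuations K X)) ∧
    -- `V_K X` is a subcone of the cone of continuous valuations and contains the Dirac masses
    ∃ (V : Submodule ℝ≥0 (ContinuousValuation X))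
      (hδ : ∀ x : X, ContinuousValuation.dirac x ∈ V),
      (V : Set (ContinuousValuation X)) = kValuations K X ∧
      -- `V_K X` is a weakly locally convex `K`-cone
      IsTopologicalCone V ∧ IsWeaklyLocallyConvex V ∧ K V ∧
      -- the universal property
      ∀ (C : Type u) [TopologicalSpace C] [AddCommMonoid C] [Module ℝ≥0 C],
        IsTopologicalCone C → IsWeaklyLocallyConvex C → K C →
        ∀ f : C(X, C), ∃! F : V →L[ℝ≥0] C,
          ∀ x : X, F ⟨ContinuousValuation.dirac x, hδ x⟩ = f x := by
  have hW := ContinuousValuation.isTopologicalCone (X := X)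
  let A := simpleValuations X
  let V := hK.kClosureSubmodule hW A
  have hδA (x : X) : ContinuousValuation.dirac x ∈ A := Submodule.subset_span ⟨x, rfl⟩
  have hδ (x : X) : ContinuousValuation.dirac x ∈ V := hK.le_kClosureSubmodule hW A (hδA x)
  refine ⟨hK.isKCompletion_kClosure _, V, hδ, rfl, hW.submodule V,
    ContinuousValuation.isWeaklyLocallyConvex.submodule V, hK.isKSpace_kClosure _, ?_⟩
  intro C _ _ _ hC hC' hKC f
  have := hC.t0
  obtain ⟨F, hF⟩ := ContinuousValuation.exists_simpleValuations_lift hC hC' f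
  obtain ⟨G, hG⟩ := hK.exists_linear_extension hW A hC hKC F
  refine ⟨G, fun x => (hG ⟨_, hδA x⟩).trans (hF x), fun G' hG' => ?_⟩
  -- Linearity forces agreement on the span of the Dirac masses; uniqueness of extensions then gives
  -- agreement on its `K`-closure.
  have hA (μ : ContinuousValuation X) (hμ : μ ∈ A) :
      G' ⟨μ, hK.le_kClosureSubmodule hW A hμ⟩ = G ⟨μ, hK.le_kClosureSubmodule hW A hμ⟩ := by
    have hle := hK.le_kClosureSubmodule hW A
    have heq : Set.EqOn (G'.toLinearMap ∘ₗ Submodule.inclusion hle)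
        (G.toLinearMap ∘ₗ Submodule.inclusion hle)
        (Submodule.span ℝ≥0 (Set.range fun x => (⟨_, hδA x⟩ : A))) := by
      refine LinearMap.eqOn_span ?_
      rintro _ ⟨x, rfl⟩
      exact (hG' x).trans ((hG ⟨_, hδA x⟩).trans (hF x)).symm
    have hμ' : (⟨μ, hμ⟩ : A) ∈ Submodule.span ℝ≥0 (Set.range fun x => (⟨_, hδA x⟩ : A)) := by
      have hmap : μ ∈ (Submodule.span ℝ≥0 (Set.range fun x => (⟨_, hδA x⟩ : A))).map A.subtype := by
        rw [Submodule.map_span, ← Set.range_comp]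
        exact hμ
      obtain ⟨ν, hν, rfl⟩ := hmap
      exact hν
    exact heq hμ'
  refine ContinuousLinearMap.ext fun v => ?_
  exact congrFun (hK.eqOn_kClosure (A := (A : Set (ContinuousValuation X)))
    (g := fun v : V => G' v) (h := fun v : V => G v) G'.continuous G.continuous
    fun a => hA a a.2) v
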